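/- A \emph{Wajsberg algebra} ($W$-algebra) is an algebra $\langle A,\to,\neg,1\rangle$ of type $(2,1,0)$ satisfying $1\to x=x$, $(x\to y)\to((y\to z)\to(x\to z))=1$, $(x\to y)\to y=(y\to x)\to x$ and $(\neg y\to\neg x)\to(x\to y)=1$. Put $0=\neg 1$, $x\vee y=(x\to y)\to y$, $x\wedge y=\neg(\neg x\vee\neg y)$, $x\oplus y=\neg y\to x$, $x\odot y=\neg(x\to\neg y)$, and $x\le y$ iff $x\to y=1$. The set $B(A)=\{x\in A: x\odot x=x\}$ is a Boolean algebra under $\vee,\wedge,\neg,0,1$. For $n\ge 1$ let $L_{n+1}$ be the algebra on $\{0,\frac1n,\dots,\frac{n-1}n,1\}$ with $x\to y=\min\{1,1-x+y\}$ and $\neg x=1-x$. A Wajsberg algebra is \emph{$(n+1)$-valued} if it belongs to the variety generated by $L_{n+1}$, i.e. satisfies every identity valid in $L_{n+1}$. For $1\le i\le n$ let $\sigma_i$ be the unary term operation on $(n+1)$-valued Wajsberg algebras that is given on $L_{n+1}$ by $\sigma_i(\frac an)=1$ if $i+a>n$ and $\sigma_i(\frac an)=0$ otherwise. Explicitly,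 $\sigma_i(x)=t_{n,n-i}(x)$, where $t_{0,c}(x)=0$, $t_{m+1,0}(x)=t_{m,0}(x)\oplus x$ and $t_{m+1,c+1}(x)=(t_{m,c+1}(x)\oplus x)\odot t_{m,c}(x)$. An \emph{implicative filter} of $A$ is a subset $F\ni 1$ such that $a,\,a\to b\in F$ implies $b\in F$; then $A/F$ is the quotient of $A$ by the congruence $x\equiv y$ iff $x\to y,\ y\to x\in F$. An implicative filter $P$ is \emph{prime} if $P\neq A$ and $x\vee y\in P$ implies $x\in P$ or $y\in P$. Write $A/P\subseteq L_{d+1}$ if there is an injective homomorphism $A/P\to L_{d+1}$. For a Boolean algebra $B$, let $B^{[n]}$ be the set of monotone functions $f:\{1,\dots,n\}\to B$ with $$(f\to g)(k)=\bigwedge_{i=1}^{n-k+1}\bigl(f(i)\to g(i+k-1)\bigr),\qquad (\neg f)(k)=\neg f(n+1-k),$$ and with the constant function $1$. Let $\mathrm{Div}(n)$ be the set of positive divisors of $n$. For a function $h$ assigning a filter $h(d)$ of $B$ to each $d\in \mathrm{Div}(n)$, let $M(B,h)$ be the subalgebra of $B^{[n]}$ consisting of all $f$ with $f\bigl(q\tfrac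 nd\bigr)\to f\bigl((q-1)\tfrac nd+1\bigr)\in h(d)$ for all $d\in \mathrm{Div}(n)$ and $1\le q\le d$. \textbf{Theorem.} Let $n\ge 1$ and let $A$ be an $(n+1)$-valued Wajsberg algebra. For $d\in \mathrm{Div}(n)$ put $h_A(d)=P_d\cap B(A)$, where $P_d$ is the intersection of all prime implicative filters $P$ of $A$ with $A/P\subseteq L_{d+1}$ (so $P_d=A$ if there are none). Then $\varphi(x)(i)=\sigma_i(x)$, $1\le i\le n$, defines a $W$-isomorphism $\varphi$ from $A$ onto $M(B(A),h_A)$, that is, a well-defined bijection that preserves $\to$, $\neg$ and $1$. -/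

import Mathlib

namespace Wajsberg

universe u v

/-! # Wajsberg algebras -/

/-- The signature of Wajsberg algebras: an implication, a negation and a constant `1`. -/
class WSig (A : Type u) where
  imp : A → A → A
  neg : A → A
  one : A

infixr:60 " ⟿ " => WSig.imp
prefix:max "∼" => WSig.neg

/-- Wajsberg algebras. -/
class WajsbergAlgebra (A : Type u) extends WSig A where
  one_imp : ∀ x : A, one ⟿ x = x
  imp_trans : ∀ x y z : A, (x ⟿ y) ⟿ ((y ⟿ z) ⟿ (x ⟿ z)) = one
  imp_comm : ∀ x y : A, (x ⟿ y) ⟿ y = (y ⟿ x) ⟿ x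
  contra : ∀ x y : A, (∼y ⟿ ∼x) ⟿ (x ⟿ y) = one

section Operations

variable {A : Type u} [WSig A]

/-- `0 = ¬ 1`. -/
def zero : A := ∼(WSig.one : A)

/-- `x ∨ y = (x → y) → y`. -/
def join (x y : A) : A := (x ⟿ y) ⟿ y

/-- `x ∧ y = ¬ (¬ x ∨ ¬ y)`. -/
def meet (x y : A) : A := ∼(join ∼x ∼y)

/-- `x ⊕ y = ¬ y → x`. -/
def oplus (x y : A) : A := ∼y ⟿ x

/-- `x ⊙ y = ¬ (x → ¬ y)`. -/
def odot (x y : A) : A := ∼(x ⟿ ∼y)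

/-- `x ≤ y` if and only if `x → y = 1`. -/
def Le (x y : A) : Prop := x ⟿ y = WSig.one

end Operations

/-! ## Homomorphisms and subalgebras -/

/-- `W`-homomorphisms. -/
structure IsWHom {A : Type u} {B : Type v} [WSig A] [WSig B] (f : A → B) : Prop where
  map_imp : ∀ x y, f (x ⟿ y) = f x ⟿ f y
  map_neg : ∀ x, f ∼x = ∼(f x)
  map_one : f WSig.one = WSig.one

/-- `W`-isomorphisms: the bijective `W`-homomorphisms. -/
structure IsWIso {A : Type u} {B : Type v} [WSig A] [WSig B] (f : A → B) : Prop
    extends IsWHom f where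
  bijective : Function.Bijective f

/-- Subsets closed under the operations. -/
structure WSubalgebra (A : Type u) [WSig A] where
  carrier : Set A
  imp_mem : ∀ {x y}, x ∈ carrier → y ∈ carrier → x ⟿ y ∈ carrier
  neg_mem : ∀ {x}, x ∈ carrier → ∼x ∈ carrier
  one_mem : WSig.one ∈ carrier

instance (A : Type u) [WSig A] : CoeSort (WSubalgebra A) (Type u) :=
  ⟨fun S => {x : A // x ∈ S.carrier}⟩

/-- A subalgebra with the restricted operations. -/
instance {A : Type u} [WSig A] (S : WSubalgebra A) : WSig S where
  imp x y := ⟨x.1 ⟿ y.1, S.imp_mem x.2 y.2⟩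
  neg x := ⟨∼x.1, S.neg_mem x.2⟩
  one := ⟨WSig.one, S.one_mem⟩

/-! ## The standard algebra `[0,1]` and its finite subalgebras -/

/-- `[0,1]` with `x → y = min {1, 1 - x + y}` and `¬ x = 1 - x`. -/
noncomputable instance : WajsbergAlgebra unitInterval where
  imp x y := ⟨min 1 (1 - (x : ℝ) + y), by
    have hx := x.2.2
    have hy := y.2.1
    exact ⟨le_min zero_le_one (by linarith), min_le_left _ _⟩⟩
  neg x := ⟨1 - (x : ℝ), by linarith [x.2.2], by linarith [x.2.1]⟩
  one := 1
  one_imp x := by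
    apply Subtype.ext
    simp [x.2.2]
  imp_trans x y z := by
    apply Subtype.ext
    have hx := x.2.1
    have hx' := x.2.2
    simp only [Set.Icc.coe_one]
    grind
  imp_comm x y := by
    apply Subtype.ext
    simp only
    grind
  contra x y := by
    apply Subtype.ext
    simp only [Set.Icc.coe_one]
    grind

/-- For `n ≥ 1`, `L n` is the subalgebra `{0, 1/n, …, (n-1)/n, 1}` of `[0,1]`, the chain with
`n + 1` elements (see `mem_L_iff`). -/
noncomputable def L (n : ℕ) : WSubalgebra unitInterval where
  carrier := {x | ∃ k : ℕ, (n : ℝ) * (x : ℝ) = k}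
  imp_mem := by
    rintro x y ⟨k, hk⟩ ⟨l, hl⟩
    refine ⟨min n (n - k + l), ?_⟩
    have hkn : k ≤ n := by
      have : (n : ℝ) * x ≤ n * 1 := mul_le_mul_of_nonneg_left x.2.2 n.cast_nonneg
      rw [hk, mul_one] at this
      exact_mod_cast this
    change (n : ℝ) * min 1 (1 - (x : ℝ) + y) = _
    rw [mul_min_of_nonneg _ _ n.cast_nonneg, mul_add, mul_sub, hk, hl]
    push_cast [Nat.cast_sub hkn]
    simp
  neg_mem := by
    rintro x ⟨k, hk⟩
    have hkn : k ≤ n := by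
      have : (n : ℝ) * x ≤ n * 1 := mul_le_mul_of_nonneg_left x.2.2 n.cast_nonneg
      rw [hk, mul_one] at this
      exact_mod_cast this
    refine ⟨n - k, ?_⟩
    change (n : ℝ) * (1 - (x : ℝ)) = _
    rw [mul_sub, hk, Nat.cast_sub hkn, mul_one]
  one_mem := ⟨n, by change (n : ℝ) * ((1 : unitInterval) : ℝ) = n; simp⟩

theorem mem_L_iff {n : ℕ} (hn : 0 < n) (x : unitInterval) :
    x ∈ (L n).carrier ↔ ∃ k : ℕ, k ≤ n ∧ (x : ℝ) = k / n := by
  have hn' : (0 : ℝ) < n := by exact_mod_cast hn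
  constructor
  · rintro ⟨k, hk⟩
    refine ⟨k, ?_, by rw [eq_div_iff hn'.ne', mul_comm]; exact hk⟩
    have : (n : ℝ) * x ≤ n * 1 := mul_le_mul_of_nonneg_left x.2.2 n.cast_nonneg
    rw [hk, mul_one] at this
    exact_mod_cast this
  · rintro ⟨k, -, hk⟩
    exact ⟨k, by rw [hk]; field_simp⟩

/-! ## Terms, identities and `(n+1)`-valued algebras -/

/-- Terms of the language of Wajsberg algebras in the variables `x₀, x₁, …`. -/
inductive WTerm : Type
  | var (i : ℕ)
  | imp (s t : WTerm)
  | neg (s : WTerm)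
  | one

instance : WSig WTerm where
  imp := WTerm.imp
  neg := WTerm.neg
  one := WTerm.one

/-- The value of a term at an assignment of the variables. -/
def WTerm.eval {A : Type u} [WSig A] (a : ℕ → A) : WTerm → A
  | .var i => a i
  | .imp s t => s.eval a ⟿ t.eval a
  | .neg s => ∼(s.eval a)
  | .one => WSig.one

/-- `A` belongs to the variety generated by the chain `L n` with `n + 1` elements: every identity
that holds in `L n` holds in `A`. -/
def IsValued (n : ℕ) (A : Type u) [WSig A] : Prop :=
  ∀ s t : WTerm, (∀ a : ℕ → L n, s.eval a = t.eval a) → ∀ a : ℕ → A, s.eval a = t.eval a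

/-! ## The operators `σ_i` -/

/-- A term in the variable `x₀` whose value in `[0,1]` is `m x - c` truncated to `[0,1]`
(see `eval_truncTerm`). -/
def truncTerm : ℕ → ℕ → WTerm
  | 0, _ => zero
  | m + 1, 0 => oplus (truncTerm m 0) (.var 0)
  | m + 1, c + 1 => odot (oplus (truncTerm m (c + 1)) (.var 0)) (truncTerm m c)

/-- The modal operators of an `(n+1)`-valued Wajsberg algebra, `1 ≤ i ≤ n`, as term operations. In
`L n` they are given by `σ_i (a / n) = 1` if `i + a > n` and `σ_i (a / n) = 0` otherwise (see
`sigma_L`), which determines them in all algebras of the variety generated by `L n`. -/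
def sigma (n i : ℕ) {A : Type u} [WSig A] (x : A) : A :=
  (truncTerm n (n - i)).eval (fun _ => x)

theorem eval_truncTerm (m c : ℕ) (a : ℕ → unitInterval) :
    (((truncTerm m c).eval a : unitInterval) : ℝ) = max 0 (min 1 (m * (a 0 : ℝ) - c)) := by
  have h0 := (a 0).2.1
  have h1 := (a 0).2.2
  have himp : ∀ x y : unitInterval, ((x ⟿ y : unitInterval) : ℝ) = min 1 (1 - (x : ℝ) + y) :=
    fun _ _ => rfl
  have hneg : ∀ x : unitInterval, ((∼x : unitInterval) : ℝ) = 1 - (x : ℝ) := fun _ => rfl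
  induction m generalizing c with
  | zero =>
    have : ((truncTerm 0 c).eval a : unitInterval) = ∼(1 : unitInterval) := by
      cases c <;> rfl
    rw [this, hneg]
    have hc : (0 : ℝ) ≤ c := c.cast_nonneg
    simp [hc]
  | succ m ih =>
    cases c with
    | zero =>
      have : ((truncTerm (m + 1) 0).eval a : unitInterval)
          = oplus ((truncTerm m 0).eval a) (a 0) := rfl
      have hm : (0 : ℝ) ≤ m * (a 0 : ℝ) := by positivity
      rw [this, oplus, himp, hneg, ih 0]
      push_cast
      grind
    | succ c =>
      have : ((truncTerm (m + 1) (c + 1)).eval a : unitInterval)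
          = odot (oplus ((truncTerm m (c + 1)).eval a) (a 0)) ((truncTerm m c).eval a) := rfl
      rw [this, odot, oplus, hneg, himp, himp, hneg, hneg, ih (c + 1), ih c]
      push_cast
      grind

theorem eval_coe {A : Type u} [WSig A] (S : WSubalgebra A) (s : WTerm) (a : ℕ → S) :
    (s.eval a).1 = s.eval (fun i => (a i).1) := by
  induction s with
  | var i => rfl
  | imp s t hs ht => simp only [WTerm.eval, ← hs, ← ht]; rfl
  | neg s hs => simp only [WTerm.eval, ← hs]; rfl
  | one => rfl

theorem sigma_L {n i k : ℕ} (hn : 0 < n) (hin : i ≤ n) (x : L n)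
    (hx : (x.1 : ℝ) = k / n) :
    ((sigma n i x).1 : ℝ) = if n < i + k then 1 else 0 := by
  have hn' : (n : ℝ) ≠ 0 := by exact_mod_cast hn.ne'
  rw [sigma, eval_coe, eval_truncTerm, hx, mul_div_cancel₀ _ hn', Nat.cast_sub hin]
  split_ifs with h
  · have : (n : ℝ) + 1 ≤ i + k := by exact_mod_cast h
    rw [min_eq_left (by linarith), max_eq_right zero_le_one]
  · have : (i : ℝ) + k ≤ n := by exact_mod_cast not_lt.1 h
    rw [min_eq_right (by linarith), max_eq_left (by linarith)]

/-! ## Elementary properties of Wajsberg algebras -/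

section Basic

open WajsbergAlgebra

variable {A : Type u} [WajsbergAlgebra A] {x y z : A}

theorem Le.refl (x : A) : Le x x := by
  have h := imp_trans (WSig.one : A) WSig.one x
  rwa [one_imp, one_imp, one_imp] at h

theorem Le.antisymm (h : Le x y) (h' : Le y x) : x = y := by
  have := imp_comm x y
  rw [show x ⟿ y = _ from h, show y ⟿ x = _ from h', one_imp, one_imp] at this
  exact this.symm

theorem Le.trans (h : Le x y) (h' : Le y z) : Le x z := by
  have := imp_trans x y z
  rwa [show x ⟿ y = _ from h, show y ⟿ z = _ from h', one_imp, one_imp] at this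

theorem le_one (x : A) : Le x WSig.one := by
  have h : (x ⟿ WSig.one) ⟿ WSig.one = (WSig.one : A) := by
    rw [imp_comm, one_imp]; exact Le.refl x
  have := imp_trans WSig.one x WSig.one
  rwa [one_imp, show (WSig.one : A) ⟿ WSig.one = _ from Le.refl _, h] at this

theorem le_imp (x y : A) : Le x (y ⟿ x) := by
  have := imp_trans y WSig.one x
  rwa [show y ⟿ WSig.one = _ from le_one y, one_imp, one_imp] at this

theorem le_join_left (x y : A) : Le x (join x y) := by
  rw [join, imp_comm]; exact le_imp _ _

theorem le_join_right (x y : A) : Le y (join x y) := le_imp _ _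

theorem imp_anti (z : A) (h : Le x y) : Le (y ⟿ z) (x ⟿ z) := by
  have := imp_trans x y z
  rwa [show x ⟿ y = _ from h, one_imp] at this

theorem exchange_le (x y z : A) : Le (x ⟿ y ⟿ z) (y ⟿ x ⟿ z) :=
  Le.trans (imp_trans x (y ⟿ z) z) (imp_anti (x ⟿ z) (le_join_left y z))

theorem exchange (x y z : A) : x ⟿ y ⟿ z = y ⟿ x ⟿ z :=
  Le.antisymm (exchange_le _ _ _) (exchange_le _ _ _)

theorem imp_trans' (x y z : A) : Le (y ⟿ z) ((x ⟿ y) ⟿ (x ⟿ z)) := by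
  rw [Le, exchange]; exact imp_trans x y z

theorem imp_mono (x : A) (h : Le y z) : Le (x ⟿ y) (x ⟿ z) := by
  have := imp_trans' x y z
  rwa [Le, show y ⟿ z = _ from h, one_imp] at this

theorem neg_le_imp (x y : A) : Le ∼x (x ⟿ y) := Le.trans (le_imp _ ∼y) (contra x y)

theorem neg_neg_le (x : A) : Le ∼∼x x := by
  have h := contra WSig.one x
  rw [one_imp] at h
  exact Le.trans (neg_le_imp ∼x ∼WSig.one) h

theorem neg_neg (x : A) : ∼∼x = x := by
  refine Le.antisymm (neg_neg_le x) ?_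
  have h := contra x ∼∼x
  rwa [show ∼∼∼x ⟿ ∼x = _ from neg_neg_le ∼x, one_imp] at h

theorem imp_contra (x y : A) : ∼y ⟿ ∼x = x ⟿ y := by
  refine Le.antisymm (contra x y) ?_
  have := contra ∼y ∼x
  rwa [neg_neg, neg_neg] at this

theorem imp_neg_comm (x y : A) : x ⟿ ∼y = y ⟿ ∼x := by
  rw [← imp_contra, neg_neg]

theorem neg_anti (h : Le x y) : Le ∼y ∼x := by
  rw [Le, imp_contra]; exact h

theorem zero_le (x : A) : Le zero x := by
  have := neg_le_imp (WSig.one : A) x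
  rwa [one_imp] at this

theorem imp_zero (x : A) : x ⟿ zero = ∼x := by
  rw [zero, imp_neg_comm, one_imp]

theorem join_le (h : Le x z) (h' : Le y z) : Le (join x y) z := by
  have e : z = (z ⟿ y) ⟿ y := by
    rw [imp_comm, show y ⟿ z = _ from h', one_imp]
  rw [e]
  exact imp_anti _ (imp_anti _ h)

theorem meet_le_left (x y : A) : Le (meet x y) x := by
  have := neg_anti (le_join_left ∼x ∼y)
  rwa [neg_neg] at this

theorem meet_le_right (x y : A) : Le (meet x y) y := by
  have := neg_anti (le_join_right ∼x ∼y)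
  rwa [neg_neg] at this

theorem le_meet (h : Le z x) (h' : Le z y) : Le z (meet x y) := by
  have := neg_anti (join_le (neg_anti h) (neg_anti h'))
  rwa [neg_neg] at this

theorem odot_comm (x y : A) : odot x y = odot y x := by
  rw [odot, imp_neg_comm]; rfl

theorem odot_le_iff : Le (odot x y) z ↔ Le x (y ⟿ z) := by
  have e : odot x y ⟿ z = x ⟿ y ⟿ z := by
    rw [odot, ← imp_contra, neg_neg, exchange, imp_contra]
  rw [Le, Le, e]

theorem odot_assoc (x y z : A) : odot (odot x y) z = odot x (odot y z) := by
  rw [odot, odot, odot, odot, imp_neg_comm, neg_neg, neg_neg, exchange, imp_neg_comm z y]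

theorem odot_mono {x' y' : A} (h : Le x x') (h' : Le y y') : Le (odot x y) (odot x' y') :=
  neg_anti (Le.trans (imp_mono _ (neg_anti h')) (imp_anti _ h))

theorem odot_le_left (x y : A) : Le (odot x y) x := odot_le_iff.2 (le_imp _ _)

theorem odot_le_right (x y : A) : Le (odot x y) y := by
  rw [odot_comm]; exact odot_le_left _ _

theorem meet_eq_odot (hx : odot x x = x) (y : A) : meet x y = odot x y := by
  refine Le.antisymm ?_ (le_meet (odot_le_left _ _) (odot_le_right _ _))
  have e : meet x y = odot (x ⟿ y) x := by
    rw [meet, join, imp_comm, imp_contra, odot]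
  have h : Le (odot (odot (x ⟿ y) x) x) (odot y x) :=
    odot_mono (odot_le_iff.2 (Le.refl _)) (Le.refl _)
  rwa [odot_assoc, hx, ← e, odot_comm y x] at h

theorem odot_self_neg (hx : odot x x = x) : odot ∼x ∼x = ∼x := by
  have h1 : x ⟿ ∼x = ∼x := by
    have := congrArg WSig.neg hx
    rwa [odot, neg_neg] at this
  have h2 : (∼x ⟿ x) ⟿ x = WSig.one := by
    rw [imp_comm, h1]; exact Le.refl _
  have h3 : ∼x ⟿ x = x := Le.antisymm h2 (le_imp _ _)
  rw [odot, neg_neg, h3]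

theorem odot_self_meet (hx : odot x x = x) (hy : odot y y = y) :
    odot (meet x y) (meet x y) = meet x y := by
  rw [meet_eq_odot hx, odot_assoc, ← odot_assoc y x y, odot_comm y x, odot_assoc x y y, hy,
    ← odot_assoc, hx]

theorem neg_meet_neg (x y : A) : ∼(meet ∼x ∼y) = join x y := by
  rw [meet, neg_neg, neg_neg, neg_neg]

theorem odot_self_join (hx : odot x x = x) (hy : odot y y = y) :
    odot (join x y) (join x y) = join x y := by
  rw [← neg_meet_neg]
  exact odot_self_neg (odot_self_meet (odot_self_neg hx) (odot_self_neg hy))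

theorem odot_neg_self (x : A) : odot x ∼x = zero := by
  rw [odot, neg_neg, show x ⟿ x = _ from Le.refl x]; rfl

theorem odot_self_one : odot (WSig.one : A) WSig.one = WSig.one := by
  rw [odot, one_imp, neg_neg]

end Basic

/-! ## The Boolean algebra of idempotents -/

/-- `B(A) = {x ∈ A : x ⊙ x = x}`. -/
def Skel (A : Type u) [WSig A] : Type u := {x : A // odot x x = x}

/-- `B(A)` with the operations `∨`, `∧`, `¬`, `0`, `1` and the order of `A`. -/
instance (A : Type u) [WajsbergAlgebra A] : BooleanAlgebra (Skel A) where
  le x y := Le x.1 y.1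
  le_refl x := Le.refl x.1
  le_trans _ _ _ h h' := Le.trans h h'
  le_antisymm _ _ h h' := Subtype.ext (Le.antisymm h h')
  sup x y := ⟨join x.1 y.1, odot_self_join x.2 y.2⟩
  le_sup_left x y := le_join_left x.1 y.1
  le_sup_right x y := le_join_right x.1 y.1
  sup_le _ _ _ h h' := join_le h h'
  inf x y := ⟨meet x.1 y.1, odot_self_meet x.2 y.2⟩
  inf_le_left x y := meet_le_left x.1 y.1
  inf_le_right x y := meet_le_right x.1 y.1
  le_inf _ _ _ h h' := le_meet h h'
  le_sup_inf x y z := by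
    change Le (meet (join x.1 y.1) (join x.1 z.1)) (join x.1 (meet y.1 z.1))
    rw [meet_eq_odot (odot_self_join x.2 y.2), odot_le_iff]
    refine join_le ?_ ?_ <;> rw [← odot_le_iff]
    · exact Le.trans (odot_le_left _ _) (le_join_left _ _)
    · rw [odot_comm, odot_le_iff]
      refine join_le ?_ ?_ <;> rw [← odot_le_iff]
      · exact Le.trans (odot_le_left _ _) (le_join_left _ _)
      · rw [odot_comm, ← meet_eq_odot y.2]
        exact le_join_right _ _
  compl x := ⟨∼x.1, odot_self_neg x.2⟩
  top := ⟨WSig.one, odot_self_one⟩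
  bot := ⟨zero, odot_self_neg odot_self_one⟩
  inf_compl_le_bot x := by
    change Le (meet x.1 ∼x.1) zero
    rw [meet_eq_odot x.2, odot_neg_self]
    exact Le.refl _
  top_le_sup_compl x := by
    change Le WSig.one (join x.1 ∼x.1)
    rw [← neg_meet_neg, meet_eq_odot (odot_self_neg x.2), odot_neg_self, zero, neg_neg]
    exact Le.refl _
  le_top x := le_one x.1
  bot_le x := zero_le x.1

/-! ## Implicative filters and quotients -/

/-- Implicative filters. -/
structure IsImpFilter {A : Type u} [WSig A] (F : Set A) : Prop where
  one_mem : WSig.one ∈ F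
  mp : ∀ {a b : A}, a ∈ F → a ⟿ b ∈ F → b ∈ F

/-- Prime implicative filters: proper, and prime as lattice filters. -/
structure IsPrimeImpFilter {A : Type u} [WSig A] (P : Set A) : Prop extends IsImpFilter P where
  ne_univ : P ≠ Set.univ
  mem_or_mem : ∀ {a b : A}, join a b ∈ P → a ∈ P ∨ b ∈ P

section Filters

open WajsbergAlgebra

variable {A : Type u} [WajsbergAlgebra A] {F : Set A}

theorem IsImpFilter.up (hF : IsImpFilter F) {a b : A} (ha : a ∈ F) (h : Le a b) : b ∈ F :=
  hF.mp ha (by rw [show a ⟿ b = _ from h]; exact hF.one_mem)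

theorem IsImpFilter.odot_mem (hF : IsImpFilter F) {a b : A} (ha : a ∈ F) (hb : b ∈ F) :
    odot a b ∈ F :=
  hF.mp hb (hF.up ha (odot_le_iff.1 (Le.refl _)))

theorem IsImpFilter.trans (hF : IsImpFilter F) {a b c : A} (h : a ⟿ b ∈ F) (h' : b ⟿ c ∈ F) :
    a ⟿ c ∈ F :=
  hF.mp h' (hF.up h (imp_trans a b c))

/-- The congruence of an implicative filter `F`: `x` and `y` are congruent when `x → y` and
`y → x` are in `F`. -/
def IsImpFilter.con (hF : IsImpFilter F) : Setoid A where
  r x y := x ⟿ y ∈ F ∧ y ⟿ x ∈ F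
  iseqv :=
    { refl := fun x => by
        rw [show x ⟿ x = _ from Le.refl x]
        exact ⟨hF.one_mem, hF.one_mem⟩
      symm := fun h => ⟨h.2, h.1⟩
      trans := fun h h' => ⟨hF.trans h.1 h'.1, hF.trans h'.2 h.2⟩ }

theorem IsImpFilter.imp_congr (hF : IsImpFilter F) {a b a' b' : A} (h : a' ⟿ a ∈ F)
    (h' : b ⟿ b' ∈ F) : (a ⟿ b) ⟿ (a' ⟿ b') ∈ F :=
  hF.trans (hF.up h (imp_trans a' a b)) (hF.up h' (imp_trans' a' b b'))

/-- The quotient algebra `A/F`. -/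
def IsImpFilter.Quot (hF : IsImpFilter F) : Type u := Quotient hF.con

instance (hF : IsImpFilter F) : WajsbergAlgebra hF.Quot where
  imp := Quotient.map₂ WSig.imp fun _ _ h _ _ h' =>
    ⟨hF.imp_congr h.2 h'.1, hF.imp_congr h.1 h'.2⟩
  neg := Quotient.map WSig.neg fun a b h => by
    refine ⟨?_, ?_⟩ <;> rw [imp_contra]
    exacts [h.2, h.1]
  one := Quotient.mk hF.con WSig.one
  one_imp x := by
    induction x using Quotient.inductionOn with
    | h x => exact congrArg (Quotient.mk hF.con) (one_imp x)
  imp_trans x y z := by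
    induction x, y, z using Quotient.inductionOn₃ with
    | h x y z => exact congrArg (Quotient.mk hF.con) (imp_trans x y z)
  imp_comm x y := by
    induction x, y using Quotient.inductionOn₂ with
    | h x y => exact congrArg (Quotient.mk hF.con) (imp_comm x y)
  contra x y := by
    induction x, y using Quotient.inductionOn₂ with
    | h x y => exact congrArg (Quotient.mk hF.con) (contra x y)

end Filters

/-! ## The Boolean skeleton and its filters -/

section Skeleton

variable (A : Type u) [WajsbergAlgebra A]

/-- `P_d`, the intersection of the prime implicative filters `P` of `A` with `A/P ⊆ L_{d+1}`, that
is, such that `A/P` is isomorphic to a subalgebra of `L d`. -/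
def primeInter (d : ℕ) : Set A :=
  {x | ∀ (P : Set A) (hP : IsPrimeImpFilter P),
    (∃ g : hP.toIsImpFilter.Quot → L d, IsWHom g ∧ Function.Injective g) → x ∈ P}

/-- `h_A(d) = P_d ∩ B(A)`, as a filter of `B(A)`. -/
def skelFilter (n : ℕ) (d : n.divisors) : Order.PFilter (Skel A) :=
  Order.IsPFilter.toPFilter (F := {b : Skel A | b.1 ∈ primeInter A d})
    (Order.IsPFilter.of_def ⟨⊤, fun _ hP _ => hP.one_mem⟩
      (fun x hx y hy => ⟨x ⊓ y, fun P hP hg => by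
          change meet x.1 y.1 ∈ P
          rw [meet_eq_odot x.2]
          exact hP.odot_mem (hx P hP hg) (hy P hP hg),
        inf_le_left, inf_le_right⟩)
      (fun hxy hx P hP hg => hP.up (hx P hP hg) hxy))

theorem mem_skelFilter {n : ℕ} {d : n.divisors} {b : Skel A} :
    b ∈ skelFilter A n d ↔ b.1 ∈ primeInter A d :=
  Iff.rfl

end Skeleton

/-! ## The algebras `B^[n]` and `M(B,h)` -/

section Tuples

/-- `B^[n]`: the monotone functions from `{1, …, n}` into `B`. -/
abbrev Tuples (n : ℕ) (B : Type u) [BooleanAlgebra B] : Type u := Set.Icc 1 n →o B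

/-- The index `k ∈ {1, …, n}`. -/
abbrev pt {n : ℕ} (k : ℕ) (h1 : 1 ≤ k) (h2 : k ≤ n) : Set.Icc 1 n := ⟨k, Set.mem_Icc.2 ⟨h1, h2⟩⟩

variable {n : ℕ} {B : Type u} [BooleanAlgebra B]

/-- `(¬ f)(k) = ¬ f(n+1-k)`, `(f → g)(k) = ⋀_{i=1}^{n-k+1} (f(i) → g(i+k-1))`, and `1` is the
constant function `1`. -/
instance : WSig (Tuples n B) where
  imp f g :=
    { toFun := fun k => Finset.univ.inf fun i : Set.Icc 1 (n - k.1 + 1) =>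
        f (pt i.1 i.2.1 (by have := i.2.2; have := k.2.1; have := k.2.2; omega)) ⇨
          g (pt (i.1 + k.1 - 1) (by have := i.2.1; have := k.2.1; omega)
            (by have := i.2.2; have := k.2.2; omega))
      monotone' := by
        intro k l hkl
        have hkl' : k.1 ≤ l.1 := hkl
        refine Finset.le_inf fun i _ => ?_
        refine (Finset.inf_le (Finset.mem_univ
          (pt i.1 i.2.1 (by have := i.2.2; omega) : Set.Icc 1 (n - k.1 + 1)))).trans ?_
        refine himp_le_himp_left (g.monotone ?_)
        change i.1 + k.1 - 1 ≤ i.1 + l.1 - 1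
        omega }
  neg f :=
    { toFun := fun k => (f (pt (n + 1 - k.1) (by have := k.2.2; omega) (by have := k.2.1; omega)))ᶜ
      monotone' := by
        intro k l hkl
        have hkl' : k.1 ≤ l.1 := hkl
        refine compl_le_compl (f.monotone ?_)
        change n + 1 - l.1 ≤ n + 1 - k.1
        omega }
  one := ⟨fun _ => ⊤, fun _ _ _ => le_rfl⟩

theorem imp_apply (f g : Tuples n B) (k : Set.Icc 1 n) :
    (f ⟿ g) k = Finset.univ.inf fun i : Set.Icc 1 (n - k.1 + 1) =>
      f (pt i.1 i.2.1 (by have := i.2.2; have := k.2.1; have := k.2.2; omega)) ⇨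
        g (pt (i.1 + k.1 - 1) (by have := i.2.1; have := k.2.1; omega)
          (by have := i.2.2; have := k.2.2; omega)) :=
  rfl

theorem block_end_mem (d : n.divisors) (q : Set.Icc 1 d.1) :
    q.1 * (n / d.1) ∈ Set.Icc 1 n := by
  have hd := Nat.dvd_of_mem_divisors d.2
  have hn := Nat.pos_of_ne_zero (Nat.mem_divisors.1 d.2).2
  refine ⟨Nat.mul_pos q.2.1 (Nat.div_pos (Nat.le_of_dvd hn hd) (Nat.pos_of_dvd_of_pos hd hn)), ?_⟩
  calc q.1 * (n / d.1) ≤ d.1 * (n / d.1) := Nat.mul_le_mul_right _ q.2.2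
    _ = n := Nat.mul_div_cancel' hd

theorem block_start_le (d : n.divisors) (q : Set.Icc 1 d.1) :
    (q.1 - 1) * (n / d.1) + 1 ≤ q.1 * (n / d.1) := by
  have hd := Nat.dvd_of_mem_divisors d.2
  have hn := Nat.pos_of_ne_zero (Nat.mem_divisors.1 d.2).2
  have h1 : 0 < n / d.1 := Nat.div_pos (Nat.le_of_dvd hn hd) (Nat.pos_of_dvd_of_pos hd hn)
  obtain ⟨r, hr⟩ : ∃ r, q.1 = r + 1 := ⟨q.1 - 1, by have := q.2.1; omega⟩
  rw [hr, Nat.add_sub_cancel, Nat.add_mul]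
  omega

/-- `ξ_{d,q}(f) = f(q (n/d)) → f((q-1) (n/d) + 1)`, for a divisor `d` of `n` and `1 ≤ q ≤ d`. -/
def xi (d : n.divisors) (q : Set.Icc 1 d.1) (f : Tuples n B) : B :=
  f (pt (q.1 * (n / d.1)) (block_end_mem d q).1 (block_end_mem d q).2) ⇨
    f (pt ((q.1 - 1) * (n / d.1) + 1) (Nat.succ_pos _)
      ((block_start_le d q).trans (block_end_mem d q).2))

theorem himp_inf_mem {F : Order.PFilter B} {ι : Type*} (s : Finset ι) (x : B) (t : ι → B)
    (h : ∀ i ∈ s, x ⇨ t i ∈ F) : x ⇨ s.inf t ∈ F := by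
  classical
  induction s using Finset.induction_on with
  | empty => simp
  | insert a s _ ih =>
    rw [Finset.inf_insert, himp_inf_distrib]
    exact Order.PFilter.inf_mem (h a (Finset.mem_insert_self a s))
      (ih fun i hi => h i (Finset.mem_insert_of_mem hi))

/-- If `r` and `s` lie in the same block of length `n/d`, then `f(r) → f(s) ∈ h(d)`. -/
theorem himp_mem_of_block (F : Order.PFilter B) (d : n.divisors) (f : Tuples n B)
    (hf : ∀ q, xi d q f ∈ F) (r s : Set.Icc 1 n)
    (hrs : (r.1 - 1) / (n / d.1) = (s.1 - 1) / (n / d.1)) : f r ⇨ f s ∈ F := by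
  have hd := Nat.dvd_of_mem_divisors d.2
  have hn := Nat.pos_of_ne_zero (Nat.mem_divisors.1 d.2).2
  have hm : 0 < n / d.1 := Nat.div_pos (Nat.le_of_dvd hn hd) (Nat.pos_of_dvd_of_pos hd hn)
  have hdm : d.1 * (n / d.1) = n := Nat.mul_div_cancel' hd
  have hr := r.2
  have hs := s.2
  have hq : (r.1 - 1) / (n / d.1) + 1 ∈ Set.Icc 1 d.1 := by
    refine ⟨Nat.succ_pos _, ?_⟩
    have : (r.1 - 1) / (n / d.1) < d.1 := by
      rw [Nat.div_lt_iff_lt_mul hm, hdm]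
      have := hr.1; have := hr.2; omega
    exact this
  refine Order.PFilter.mem_of_le ?_ (hf ⟨_, hq⟩)
  refine himp_le_himp (f.monotone ?_) (f.monotone ?_)
  · change r.1 ≤ ((r.1 - 1) / (n / d.1) + 1) * (n / d.1)
    have := Nat.lt_div_mul_add (a := r.1 - 1) hm
    rw [Nat.add_mul, one_mul]
    omega
  · change ((r.1 - 1) / (n / d.1) + 1 - 1) * (n / d.1) + 1 ≤ s.1
    rw [Nat.add_sub_cancel, hrs]
    have := Nat.div_mul_le_self (s.1 - 1) (n / d.1)
    have := hs.1
    omega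

theorem himp_himp_mem {F : Order.PFilter B} {x a a' c c' : B} (h : x ≤ a' ⇨ c)
    (ha : a ⇨ a' ∈ F) (hc : c ⇨ c' ∈ F) : x ⇨ a ⇨ c' ∈ F := by
  refine Order.PFilter.mem_of_le ?_ (Order.PFilter.inf_mem ha hc)
  rw [le_himp_iff, le_himp_iff]
  have h1 : (a ⇨ a') ⊓ (c ⇨ c') ⊓ x ⊓ a ≤ a' :=
    (le_inf (inf_le_left.trans (inf_le_left.trans inf_le_left)) inf_le_right).trans
      himp_inf_le
  have h2 : (a ⇨ a') ⊓ (c ⇨ c') ⊓ x ⊓ a ≤ c :=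
    (le_inf (inf_le_left.trans (inf_le_right.trans h)) h1).trans himp_inf_le
  exact (le_inf (inf_le_left.trans (inf_le_left.trans inf_le_right)) h2).trans himp_inf_le

/-- `M(B,h) = {f ∈ B^[n] : ξ_{d,q}(f) ∈ h(d) for all d ∈ Div(n) and 1 ≤ q ≤ d}`, a subalgebra
of `B^[n]`. -/
def M (h : n.divisors → Order.PFilter B) :
    WSubalgebra (Tuples n B) where
  carrier := {f | ∀ (d : n.divisors) (q : Set.Icc 1 d.1), xi d q f ∈ h d}
  imp_mem := by
    intro f g hf hg d q
    have hd := Nat.dvd_of_mem_divisors d.2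
    have hn := Nat.pos_of_ne_zero (Nat.mem_divisors.1 d.2).2
    have hm : 0 < n / d.1 := Nat.div_pos (Nat.le_of_dvd hn hd) (Nat.pos_of_dvd_of_pos hd hn)
    have hdm : d.1 * (n / d.1) = n := Nat.mul_div_cancel' hd
    have hfm := himp_mem_of_block (h d) d f (hf d)
    have hgm := himp_mem_of_block (h d) d g (hg d)
    unfold xi
    rw [imp_apply f g (pt ((q.1 - 1) * (n / d.1) + 1) _ _)]
    refine himp_inf_mem (F := h d) Finset.univ _ _ fun j _ => ?_
    have hend := block_end_mem d q
    have hst := block_start_le d q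
    have hj2 : j.1 ≤ n - ((q.1 - 1) * (n / d.1) + 1) + 1 := j.2.2
    have hj1 := j.2.1
    obtain ⟨p, hp⟩ : ∃ p, q.1 = p + 1 := ⟨q.1 - 1, by have := q.2.1; omega⟩
    have hp' : q.1 - 1 = p := by omega
    have hrm : (q.1 - 1) * (n / d.1) = p * (n / d.1) := by rw [hp']
    have hqm : q.1 * (n / d.1) = p * (n / d.1) + n / d.1 := by rw [hp, Nat.add_mul, one_mul]
    have hb1 := Nat.div_mul_le_self (j.1 - 1) (n / d.1)
    have hb2 := Nat.lt_div_mul_add (a := j.1 - 1) hm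
    have hb5 := hend.2
    have hb3 : (j.1 - 1) / (n / d.1) + q.1 ≤ d.1 := by
      by_contra hcon
      have h1 : (d.1 + 1) * (n / d.1) ≤ ((j.1 - 1) / (n / d.1) + q.1) * (n / d.1) :=
        Nat.mul_le_mul_right _ (by omega)
      rw [Nat.add_mul, Nat.add_mul, one_mul, hdm] at h1
      omega
    have hb4 : (j.1 - 1) / (n / d.1) * (n / d.1) + q.1 * (n / d.1) ≤ n := by
      rw [← Nat.add_mul]
      exact (Nat.mul_le_mul_right _ hb3).trans hdm.le
    have hqm1 := hend.1
    refine himp_himp_mem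
      (a' := f (pt ((j.1 - 1) / (n / d.1) * (n / d.1) + 1) (Nat.succ_pos _) (by omega)))
      (c := g (pt ((j.1 - 1) / (n / d.1) * (n / d.1) + 1 + q.1 * (n / d.1) - 1) (by omega)
        (by omega)))
      ?_ (hfm _ _ ?_) (hgm _ _ ?_)
    · rw [imp_apply f g (pt (q.1 * (n / d.1)) _ _)]
      exact Finset.inf_le (Finset.mem_univ
        (pt ((j.1 - 1) / (n / d.1) * (n / d.1) + 1) (Nat.succ_pos _) (by omega) :
          Set.Icc 1 (n - q.1 * (n / d.1) + 1)))
    · simp only [Nat.add_sub_cancel]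
      rw [Nat.mul_div_cancel _ hm]
    · have e : ∀ t, (j.1 - 1) / (n / d.1) * (n / d.1) + p * (n / d.1) ≤ t →
          t < (j.1 - 1) / (n / d.1) * (n / d.1) + p * (n / d.1) + n / d.1 →
          t / (n / d.1) = (j.1 - 1) / (n / d.1) + p := by
        intro t h1 h2
        refine Nat.div_eq_of_lt_le ?_ ?_
        · rw [Nat.add_mul]; exact h1
        · rw [Nat.add_mul, Nat.add_mul, one_mul]; exact h2
      change ((j.1 - 1) / (n / d.1) * (n / d.1) + 1 + q.1 * (n / d.1) - 1 - 1) / (n / d.1)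
        = (j.1 + ((q.1 - 1) * (n / d.1) + 1) - 1 - 1) / (n / d.1)
      exact (e _ (by omega) (by omega)).trans (e _ (by omega) (by omega)).symm
  neg_mem := by
    intro f hf d q
    have hd := Nat.dvd_of_mem_divisors d.2
    have hdm : d.1 * (n / d.1) = n := Nat.mul_div_cancel' hd
    obtain ⟨r, hr⟩ : ∃ r, d.1 + 1 = q.1 + r := ⟨d.1 + 1 - q.1, by have := q.2.2; omega⟩
    have h1 : n + n / d.1 = q.1 * (n / d.1) + r * (n / d.1) := by
      rw [← Nat.add_mul, ← hr, Nat.add_mul, hdm, one_mul]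
    have hr' : r ∈ Set.Icc 1 d.1 := by
      have := q.2.1; have := q.2.2
      exact ⟨by omega, by omega⟩
    have hst := block_start_le d q
    have hst' := block_start_le d ⟨r, hr'⟩
    have hend := (block_end_mem d q).2
    have e1 : (q.1 - 1) * (n / d.1) = q.1 * (n / d.1) - n / d.1 := by
      rw [Nat.sub_mul, one_mul]
    have e2 : (r - 1) * (n / d.1) = r * (n / d.1) - n / d.1 := by
      rw [Nat.sub_mul, one_mul]
    refine Order.PFilter.mem_of_le (le_of_eq ?_) (hf d ⟨r, hr'⟩)
    have e : ∀ x y : B, xᶜ ⇨ yᶜ = y ⇨ x := fun x y => compl_himp_compl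
    refine Eq.trans ?_ (e _ _).symm
    unfold xi
    have a1 : r * (n / d.1) = n + 1 - ((q.1 - 1) * (n / d.1) + 1) := by
      have h2 : n / d.1 ≤ q.1 * (n / d.1) := Nat.le_mul_of_pos_left _ q.2.1
      omega
    have a2 : (r - 1) * (n / d.1) + 1 = n + 1 - q.1 * (n / d.1) := by
      have h2 : n / d.1 ≤ r * (n / d.1) := Nat.le_mul_of_pos_left _ hr'.1
      omega
    congr 2
    · exact Subtype.ext a1
    · exact Subtype.ext a2
  one_mem := by
    intro d q
    change (⊤ : B) ⇨ ⊤ ∈ h d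
    simp

end Tuples

end Wajsberg

/-!
The map `φ` (`modal`) is studied through identities of `L n` and at the prime ideals of the Boolean
algebra `B(A)`.

An identity holds in `A` as soon as it holds at all fractions `k / n` in `[0,1]`
(`IsValued.eval_eq`), where `σ_i (k / n)` is `1` or `0` according to whether `i + k > n`. In this way
one sees that the `σ_i (x)` are idempotent and increase with `i`, that `φ` preserves `→`, `¬` and `1`
(`isWHom_modal`), and that `σ_1 (x) ≤ x`, which makes `φ` injective (`modal_injective`).

A monotone tuple `f` over a Boolean algebra `B` has at each prime ideal `J` of `B` a rank, the number
of indices `i` with `f i ∉ J`, and `f ↦ rank / n` is a homomorphism from `B^[n]` to `[0,1]`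
(`isWHom_value`). After `φ` this is a homomorphism from `A` to `[0,1]`, whose kernel is a prime
implicative filter. The range of this homomorphism is a subalgebra of `L n`, hence equal to `L d` for
some `d ∣ n` (`exists_dvd_of_closed`), and so the kernel is one of the filters that define `h_A(d)`. If `f`
satisfies the conditions `ξ_{d,q}` modulo `h_A(d)`, its membership in `J` is constant on the blocks
of length `n / d`; then the rank of `f` is a multiple of `n / d` and is the rank of some `φ(x)`
(`exists_rank_modal_eq`). Conversely the tuples `φ(x)` satisfy these conditions, by a computation in
`L d` (`modal_mem_M`).

The local solutions `x` are glued by the prime ideal theorem: for `f` in `M(B(A), h_A)`, the `b` in `B(A)` below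
which `f` agrees with some `φ(x)` form an ideal, since `(b ∧ x) ∨ (¬ b ∧ y)` patches two solutions, and no
prime ideal contains it (`exists_modal_eq`).
-/

namespace Wajsberg

universe u v

open WajsbergAlgebra

/-! ### Homomorphisms, terms and transfer of identities -/

section Transfer

variable {A : Type u} {B : Type v} [WSig A] [WSig B]

theorem IsWHom.map_eval {f : A → B} (hf : IsWHom f) (s : WTerm) (a : ℕ → A) :
    f (s.eval a) = s.eval (fun i => f (a i)) := by
  induction s with
  | var i => rfl
  | imp s t hs ht => simp only [WTerm.eval, hf.map_imp, hs, ht]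
  | neg s hs => simp only [WTerm.eval, hf.map_neg, hs]
  | one => exact hf.map_one

theorem IsWHom.map_sigma {f : A → B} (hf : IsWHom f) (n i : ℕ) (x : A) :
    f (sigma n i x) = sigma n i (f x) :=
  hf.map_eval _ _

theorem IsWHom.map_join {f : A → B} (hf : IsWHom f) (x y : A) :
    f (join x y) = join (f x) (f y) := by
  simp only [join, hf.map_imp]

theorem IsWHom.map_meet {f : A → B} (hf : IsWHom f) (x y : A) :
    f (meet x y) = meet (f x) (f y) := by
  simp only [meet, hf.map_neg, hf.map_join]

theorem IsWHom.map_odot {f : A → B} (hf : IsWHom f) (x y : A) :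
    f (odot x y) = odot (f x) (f y) := by
  simp only [odot, hf.map_neg, hf.map_imp]

/-- The evaluation of terms is a homomorphism from the term algebra. Since `∨`, `∧`, `⊙` and `σ_i`
are defined in every algebra of the signature, they also form terms, and evaluation commutes
with them. -/
theorem WTerm.isWHom_eval (a : ℕ → A) : IsWHom (WTerm.eval a) :=
  ⟨fun _ _ => rfl, fun _ => rfl, rfl⟩

/-- The meet `t 0 ∧ … ∧ t (m - 1)`. -/
def bigMeet (t : ℕ → A) : ℕ → A
  | 0 => WSig.one
  | m + 1 => meet (bigMeet t m) (t m)

theorem IsWHom.map_bigMeet {f : A → B} (hf : IsWHom f) (t : ℕ → A) (m : ℕ) :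
    f (bigMeet t m) = bigMeet (fun i => f (t i)) m := by
  induction m with
  | zero => exact hf.map_one
  | succ m ih => simp only [bigMeet, hf.map_meet, ih]

/-- The assignment of `x` to the variable `x₀` and of `y` to all others. -/
def assign (x y : A) : ℕ → A
  | 0 => x
  | _ + 1 => y

/-- An identity in two variables holds in an `(n+1)`-valued algebra as soon as it holds for all
arguments `k / n`, `l / n` in `[0,1]`; these are the values of `x₀` and `x₁`. -/
theorem IsValued.eval_eq {n : ℕ} (hA : IsValued n A) (hn : 0 < n) {s t : WTerm}
    (h : ∀ (x y : unitInterval) (k l : ℕ), k ≤ n → l ≤ n → (x : ℝ) = k / n → (y : ℝ) = l / n →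
      ∀ a : ℕ → unitInterval, a 0 = x → a 1 = y → s.eval a = t.eval a) (x y : A) :
    s.eval (assign x y) = t.eval (assign x y) := by
  refine hA s t (fun a => ?_) _
  apply Subtype.ext
  rw [eval_coe, eval_coe]
  obtain ⟨k, hk, hxk⟩ := (mem_L_iff hn _).1 (a 0).2
  obtain ⟨l, hl, hyl⟩ := (mem_L_iff hn _).1 (a 1).2
  exact h _ _ k l hk hl hxk hyl _ rfl rfl

end Transfer

section BigMeet

variable {A : Type u} [WajsbergAlgebra A]

theorem bigMeet_le (t : ℕ → A) {m i : ℕ} (hi : i < m) : Le (bigMeet t m) (t i) := by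
  induction m with
  | zero => omega
  | succ m ih =>
    rcases Nat.lt_succ_iff_lt_or_eq.1 hi with h | rfl
    · exact Le.trans (meet_le_left _ _) (ih h)
    · exact meet_le_right _ _

theorem le_bigMeet {t : ℕ → A} {m : ℕ} {x : A} (h : ∀ i < m, Le x (t i)) :
    Le x (bigMeet t m) := by
  induction m with
  | zero => exact le_one x
  | succ m ih => exact le_meet (ih fun i hi => h i (by omega)) (h m (by omega))

end BigMeet

/-! ### Computations in the standard algebra -/

section Standard

theorem coe_imp (x y : unitInterval) :
    ((x ⟿ y : unitInterval) : ℝ) = min 1 (1 - (x : ℝ) + y) := rfl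

theorem coe_neg (x : unitInterval) : ((∼x : unitInterval) : ℝ) = 1 - (x : ℝ) := rfl

theorem coe_one : ((WSig.one : unitInterval) : ℝ) = 1 := rfl

theorem coe_join (x y : unitInterval) : ((join x y : unitInterval) : ℝ) = max (x : ℝ) y := by
  have := x.2.2
  have := y.2.2
  rw [join, coe_imp, coe_imp]
  grind

theorem coe_meet (x y : unitInterval) : ((meet x y : unitInterval) : ℝ) = min (x : ℝ) y := by
  rw [meet, coe_neg, coe_join, coe_neg, coe_neg]
  grind

theorem coe_odot (x y : unitInterval) :
    ((odot x y : unitInterval) : ℝ) = max 0 ((x : ℝ) + y - 1) := by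
  rw [odot, coe_neg, coe_imp, coe_neg]
  grind

theorem le_iff_coe {x y : unitInterval} : Le x y ↔ (x : ℝ) ≤ y := by
  rw [Le, Subtype.ext_iff, coe_imp, coe_one]
  grind

theorem coe_imp_of_eq {x y : unitInterval} {n k l : ℕ} (hn : 0 < n) (hk : k ≤ n)
    (hx : (x : ℝ) = k / n) (hy : (y : ℝ) = l / n) :
    ((x ⟿ y : unitInterval) : ℝ) = (min n (n - k + l) : ℕ) / n := by
  have : (n : ℝ) ≠ 0 := by exact_mod_cast hn.ne'
  rw [coe_imp, hx, hy, Nat.cast_min, ← min_div_div_right n.cast_nonneg, div_self this]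
  push_cast [Nat.cast_sub hk]
  congr 1
  field_simp

/-- In `[0,1]`, `σ_i (k / d)` is `1` or `0` according to whether `i + (n / d) k > n` or not. -/
theorem coe_sigma {n d m i k : ℕ} (hn : 0 < n) (hdm : d * m = n) (hin : i ≤ n) {x : unitInterval}
    (hx : (x : ℝ) = k / d) :
    ((sigma n i x : unitInterval) : ℝ) = if n < i + m * k then 1 else 0 := by
  have hd : (d : ℝ) ≠ 0 := by
    rintro h
    rw [Nat.cast_eq_zero.1 h] at hdm
    omega
  have e : (n : ℝ) * (k / d) = m * k := by
    rw [← hdm]; push_cast; field_simp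
  rw [sigma, eval_truncTerm, hx, e, Nat.cast_sub hin]
  split_ifs with h
  · have : (n : ℝ) + 1 ≤ i + m * k := by exact_mod_cast h
    rw [min_eq_left (by linarith), max_eq_right zero_le_one]
  · have : (i : ℝ) + m * k ≤ n := by exact_mod_cast not_lt.1 h
    rw [min_eq_right (by linarith), max_eq_left (by linarith)]

theorem coe_sigma_self {n i k : ℕ} (hn : 0 < n) (hin : i ≤ n) {x : unitInterval}
    (hx : (x : ℝ) = k / n) :
    ((sigma n i x : unitInterval) : ℝ) = if n < i + k then 1 else 0 := by
  simpa using coe_sigma hn (mul_one n) hin hx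

end Standard

/-! ### Identities of the operators `σ_i` -/

section Identities

variable {A : Type u} [WajsbergAlgebra A] {n : ℕ}

theorem odot_sigma_self (hA : IsValued n A) (hn : 0 < n) {i : ℕ} (hi : i ≤ n) (x : A) :
    odot (sigma n i x) (sigma n i x) = sigma n i x := by
  have := hA.eval_eq hn (s := odot (sigma n i (WTerm.var 0)) (sigma n i (WTerm.var 0)))
    (t := sigma n i (WTerm.var 0)) (by
      rintro x y k l hk hl hx hy a rfl rfl
      simp only [(WTerm.isWHom_eval _).map_odot, (WTerm.isWHom_eval _).map_sigma]
      apply Subtype.ext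
      rw [coe_odot, WTerm.eval, coe_sigma_self hn hi hx]
      split_ifs <;> norm_num) x x
  simp only [(WTerm.isWHom_eval _).map_odot, (WTerm.isWHom_eval _).map_sigma] at this
  exact this

theorem sigma_le_sigma (hA : IsValued n A) (hn : 0 < n) {i j : ℕ} (hij : i ≤ j) (hj : j ≤ n)
    (x : A) : Le (sigma n i x) (sigma n j x) := by
  have := hA.eval_eq hn (s := sigma n i (WTerm.var 0) ⟿ sigma n j (WTerm.var 0))
    (t := WSig.one) (by
      rintro x y k l hk hl hx hy a rfl rfl
      simp only [(WTerm.isWHom_eval _).map_imp, (WTerm.isWHom_eval _).map_sigma]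
      refine le_iff_coe.2 ?_
      rw [WTerm.eval, coe_sigma_self hn (hij.trans hj) hx, coe_sigma_self hn hj hx]
      split_ifs <;> first | omega | norm_num) x x
  simp only [(WTerm.isWHom_eval _).map_imp, (WTerm.isWHom_eval _).map_sigma] at this
  exact this

theorem sigma_neg (hA : IsValued n A) (hn : 0 < n) {k : ℕ} (hk1 : 1 ≤ k) (hk : k ≤ n) (x : A) :
    sigma n k ∼x = ∼(sigma n (n + 1 - k) x) := by
  have := hA.eval_eq hn (s := sigma n k ∼(WTerm.var 0))
    (t := ∼(sigma n (n + 1 - k) (WTerm.var 0))) (by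
      rintro x y a l ha hl hx hy v rfl rfl
      simp only [(WTerm.isWHom_eval _).map_neg, (WTerm.isWHom_eval _).map_sigma]
      apply Subtype.ext
      have hx' : ((∼(v 0) : unitInterval) : ℝ) = (n - a : ℕ) / n := by
        rw [coe_neg, hx, Nat.cast_sub ha]
        field_simp
      rw [coe_neg, WTerm.eval, coe_sigma_self hn hk hx', coe_sigma_self hn (by omega) hx]
      split_ifs <;> first | omega | norm_num) x x
  simp only [(WTerm.isWHom_eval _).map_neg, (WTerm.isWHom_eval _).map_sigma] at this
  exact this

theorem sigma_one (hA : IsValued n A) (hn : 0 < n) {k : ℕ} (hk1 : 1 ≤ k) (hk : k ≤ n) :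
    sigma n k (WSig.one : A) = WSig.one := by
  have := hA.eval_eq hn (s := sigma n k WSig.one) (t := WSig.one) (by
      rintro x y a l ha hl hx hy v rfl rfl
      simp only [(WTerm.isWHom_eval _).map_one, (WTerm.isWHom_eval _).map_sigma]
      apply Subtype.ext
      have hx' : ((WSig.one : unitInterval) : ℝ) = n / n := by
        rw [coe_one]
        field_simp
      rw [coe_one, coe_sigma_self hn hk hx', if_pos (by omega)]) WSig.one WSig.one
  simp only [(WTerm.isWHom_eval _).map_one, (WTerm.isWHom_eval _).map_sigma] at this
  exact this

/-- This identity makes `φ` injective: it turns `σ_1 (x → y) = 1` into `x ≤ y`. -/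
theorem sigma_first_le (hA : IsValued n A) (hn : 0 < n) (x : A) : Le (sigma n 1 x) x := by
  have := hA.eval_eq hn (s := sigma n 1 (WTerm.var 0) ⟿ WTerm.var 0) (t := WSig.one) (by
      rintro x y k l hk hl hx hy a rfl rfl
      simp only [(WTerm.isWHom_eval _).map_imp, (WTerm.isWHom_eval _).map_sigma]
      refine le_iff_coe.2 ?_
      rw [WTerm.eval, coe_sigma_self hn hn hx]
      split_ifs with h
      · obtain rfl : k = n := by omega
        rw [hx, div_self (by exact_mod_cast hn.ne')]
      · exact (a 0).2.1) x x
  simp only [(WTerm.isWHom_eval _).map_imp, (WTerm.isWHom_eval _).map_sigma] at this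
  exact this

theorem sigma_join (hA : IsValued n A) (hn : 0 < n) {i : ℕ} (hi : i ≤ n) (x y : A) :
    sigma n i (join x y) = join (sigma n i x) (sigma n i y) := by
  have := hA.eval_eq hn (s := sigma n i (join (WTerm.var 0) (WTerm.var 1)))
    (t := join (sigma n i (WTerm.var 0)) (sigma n i (WTerm.var 1))) (by
      rintro x y k l hk hl hx hy a rfl rfl
      simp only [(WTerm.isWHom_eval _).map_join, (WTerm.isWHom_eval _).map_sigma]
      apply Subtype.ext
      have hxy : ((join (a 0) (a 1) : unitInterval) : ℝ) = (max k l : ℕ) / n := by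
        rw [coe_join, hx, hy, Nat.cast_max, max_div_div_right n.cast_nonneg]
      rw [coe_join, WTerm.eval, WTerm.eval, coe_sigma_self hn hi hx, coe_sigma_self hn hi hy,
        coe_sigma_self hn hi hxy]
      split_ifs <;> first | omega | norm_num) x y
  simp only [(WTerm.isWHom_eval _).map_join, (WTerm.isWHom_eval _).map_sigma] at this
  exact this

theorem sigma_meet (hA : IsValued n A) (hn : 0 < n) {i : ℕ} (hi : i ≤ n) (x y : A) :
    sigma n i (meet x y) = meet (sigma n i x) (sigma n i y) := by
  have := hA.eval_eq hn (s := sigma n i (meet (WTerm.var 0) (WTerm.var 1)))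
    (t := meet (sigma n i (WTerm.var 0)) (sigma n i (WTerm.var 1))) (by
      rintro x y k l hk hl hx hy a rfl rfl
      simp only [(WTerm.isWHom_eval _).map_meet, (WTerm.isWHom_eval _).map_sigma]
      apply Subtype.ext
      have hxy : ((meet (a 0) (a 1) : unitInterval) : ℝ) = (min k l : ℕ) / n := by
        rw [coe_meet, hx, hy, Nat.cast_min, min_div_div_right n.cast_nonneg]
      rw [coe_meet, WTerm.eval, WTerm.eval, coe_sigma_self hn hi hx, coe_sigma_self hn hi hy,
        coe_sigma_self hn hi hxy]
      split_ifs <;> first | omega | norm_num) x y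
  simp only [(WTerm.isWHom_eval _).map_meet, (WTerm.isWHom_eval _).map_sigma] at this
  exact this

theorem sigma_imp_le (hA : IsValued n A) (hn : 0 < n) {i k : ℕ} (hi : 1 ≤ i) (hk : 1 ≤ k)
    (hik : i + k - 1 ≤ n) (x y : A) :
    Le (sigma n k (x ⟿ y)) (sigma n i x ⟿ sigma n (i + k - 1) y) := by
  have := hA.eval_eq hn (s := sigma n k (WTerm.var 0 ⟿ WTerm.var 1) ⟿
      (sigma n i (WTerm.var 0) ⟿ sigma n (i + k - 1) (WTerm.var 1))) (t := WSig.one) (by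
      rintro x y p q hp hq hx hy a rfl rfl
      simp only [(WTerm.isWHom_eval _).map_imp, (WTerm.isWHom_eval _).map_sigma]
      refine le_iff_coe.2 ?_
      rw [coe_imp, WTerm.eval, WTerm.eval, coe_sigma_self hn (by omega) hx, coe_sigma_self hn hik hy,
        coe_sigma_self hn (by omega) (coe_imp_of_eq hn hp hx hy)]
      split_ifs <;> first | omega | norm_num) x y
  simp only [(WTerm.isWHom_eval _).map_imp, (WTerm.isWHom_eval _).map_sigma] at this
  exact this

/-- With `sigma_imp_le`, this says that `φ` preserves `→`; the meet is indexed from `0`. -/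
theorem bigMeet_le_sigma_imp (hA : IsValued n A) (hn : 0 < n) {k : ℕ} (hk : 1 ≤ k)
    (hkn : k ≤ n) (x y : A) :
    Le (bigMeet (fun i => sigma n (i + 1) x ⟿ sigma n (i + k) y) (n - k + 1))
      (sigma n k (x ⟿ y)) := by
  have := hA.eval_eq hn (s := bigMeet (fun i => sigma n (i + 1) (WTerm.var 0) ⟿
      sigma n (i + k) (WTerm.var 1)) (n - k + 1) ⟿ sigma n k (WTerm.var 0 ⟿ WTerm.var 1))
    (t := WSig.one) (by
      rintro x y p q hp hq hx hy a rfl rfl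
      simp only [(WTerm.isWHom_eval _).map_imp, (WTerm.isWHom_eval _).map_sigma,
        (WTerm.isWHom_eval _).map_bigMeet]
      have hxy := coe_sigma_self hn hkn (coe_imp_of_eq hn hp hx hy)
      by_cases h : n < k + min n (n - p + q)
      · refine le_iff_coe.2 ?_
        rw [WTerm.eval, WTerm.eval, hxy, if_pos h]
        exact unitInterval.le_one _
      -- the index `n + 1 - p`, the least one with `σ_i x = 1`, refutes the meet
      · refine Le.trans (bigMeet_le _ (show n - p < n - k + 1 by omega)) (le_iff_coe.2 ?_)
        simp only [WTerm.eval]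
        rw [hxy, coe_imp, coe_sigma_self hn (by omega) hx, coe_sigma_self hn (by omega) hy, if_neg h,
          if_pos (by omega), if_neg (by omega)]
        norm_num) x y
  simp only [(WTerm.isWHom_eval _).map_imp, (WTerm.isWHom_eval _).map_sigma,
    (WTerm.isWHom_eval _).map_bigMeet] at this
  exact this

/-- On an idempotent element, the truncated multiple `m u - c` is `u` or `0`. -/
theorem eval_truncTerm_of_odot_self {u : A} (hu : odot u u = u) (m c : ℕ) :
    (truncTerm m c).eval (fun _ => u) = if c < m then u else zero := by
  have huu : oplus u u = u := by
    have := congrArg WSig.neg (odot_self_neg hu)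
    rwa [odot, neg_neg, neg_neg] at this
  have hzu : oplus zero u = u := by rw [oplus, imp_zero, neg_neg]
  have huz : odot u zero = zero := Le.antisymm (odot_le_right _ _) (zero_le _)
  induction m generalizing c with
  | zero => cases c <;> rfl
  | succ m ih =>
    cases c with
    | zero =>
      change oplus ((truncTerm m 0).eval _) u = _
      rw [ih]
      split_ifs <;> omega
    | succ c =>
      change odot (oplus ((truncTerm m (c + 1)).eval _) u) ((truncTerm m c).eval _) = _
      rw [ih, ih]
      have e : oplus (if c + 1 < m then u else zero) u = u := by
        split_ifs <;> assumption
      rw [e]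
      split_ifs <;> omega

theorem sigma_of_odot_self {u : A} (hu : odot u u = u) {i : ℕ} (hi : 1 ≤ i) (hin : i ≤ n) :
    sigma n i u = u := by
  rw [sigma, eval_truncTerm_of_odot_self hu, if_pos (by omega)]

end Identities

/-! ### The embedding of an algebra into the tuples over its skeleton -/

section Modal

variable {A : Type u} [WajsbergAlgebra A] {n : ℕ}

theorem Skel.coe_himp (a b : Skel A) : (a ⇨ b).1 = a.1 ⟿ b.1 := by
  have e : a ⇨ b = (a ⊓ bᶜ)ᶜ := by rw [himp_eq, compl_inf, compl_compl, sup_comm]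
  rw [e]
  change ∼(meet a.1 ∼b.1) = _
  rw [meet_eq_odot a.2, odot, neg_neg, neg_neg]

/-- The map `φ` with `φ(x)(i) = σ_i(x)`, as a map into all of `B(A)^[n]`. -/
def modal (hA : IsValued n A) (hn : 0 < n) (x : A) : Tuples n (Skel A) where
  toFun i := ⟨sigma n i.1 x, odot_sigma_self hA hn i.2.2 x⟩
  monotone' _ j hij := sigma_le_sigma hA hn hij j.2.2 x

theorem isWHom_modal (hA : IsValued n A) (hn : 0 < n) : IsWHom (modal hA hn) where
  map_imp x y := by
    ext k
    have hk := k.2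
    refine le_antisymm ?_ ?_
    · rw [imp_apply]
      refine Finset.le_inf fun i _ => ?_
      have hi := i.2
      have hi2 : i.1 ≤ n - k.1 + 1 := i.2.2
      change Le (sigma n k.1 (x ⟿ y)) (_ : Skel A).1
      rw [Skel.coe_himp]
      exact sigma_imp_le hA hn hi.1 hk.1 (by have := hk.2; omega) x y
    · refine Le.trans (le_bigMeet fun i hi => ?_) (bigMeet_le_sigma_imp hA hn hk.1 hk.2 x y)
      rw [imp_apply]
      have h := Finset.inf_le (f := fun i : Set.Icc 1 (n - k.1 + 1) =>
        modal hA hn x (pt i.1 i.2.1 (by have := i.2.2; have := hk.1; have := hk.2; omega)) ⇨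
          modal hA hn y (pt (i.1 + k.1 - 1) (by have := i.2.1; have := hk.1; omega)
            (by have := i.2.2; have := hk.2; omega)))
        (Finset.mem_univ (pt (i + 1) (by omega) (by omega)))
      refine Le.trans h ?_
      rw [Skel.coe_himp]
      have e : i + 1 + k.1 - 1 = i + k.1 := by omega
      change Le (sigma n (i + 1) x ⟿ sigma n (i + 1 + k.1 - 1) y) _
      rw [e]
      exact Le.refl _
  map_neg x := by
    ext k
    exact Subtype.ext (sigma_neg hA hn k.2.1 k.2.2 x)
  map_one := by
    ext k
    exact Subtype.ext (sigma_one hA hn k.2.1 k.2.2)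

theorem modal_injective (hA : IsValued n A) (hn : 0 < n) :
    Function.Injective (modal hA hn) := by
  have key : ∀ x y : A, modal hA hn x = modal hA hn y → Le x y := by
    intro x y h
    have h1 : modal hA hn (x ⟿ y) = WSig.one := by
      rw [(isWHom_modal hA hn).map_imp, ← h, ← (isWHom_modal hA hn).map_imp,
        show x ⟿ x = _ from Le.refl x, (isWHom_modal hA hn).map_one]
    have h2 : sigma n 1 (x ⟿ y) = WSig.one :=
      congrArg Subtype.val (DFunLike.congr_fun h1 (pt 1 le_rfl hn))
    have h3 := sigma_first_le hA hn (x ⟿ y)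
    rw [h2] at h3
    exact Le.antisymm (le_one _) h3
  exact fun x y h => Le.antisymm (key x y h) (key y x h.symm)

end Modal

/-! ### Values of tuples at a prime ideal -/

section Rank

open Order

variable {n : ℕ} {B : Type u} [BooleanAlgebra B] {J : Ideal B}

theorem compl_notMem_iff (hJ : J.IsPrime) {a : B} : aᶜ ∉ J ↔ a ∈ J :=
  ⟨hJ.mem_or_compl_mem.resolve_right, fun h h' => hJ.notMem_of_compl_mem h' h⟩

theorem himp_notMem_iff (hJ : J.IsPrime) {a b : B} : a ⇨ b ∉ J ↔ (a ∉ J → b ∉ J) := by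
  have := compl_notMem_iff hJ (a := a)
  rw [himp_eq, Ideal.sup_mem_iff]
  tauto

theorem finset_inf_notMem_iff (hJ : J.IsPrime) {ι : Type*} (s : Finset ι) (f : ι → B) :
    s.inf f ∉ J ↔ ∀ i ∈ s, f i ∉ J := by
  classical
  induction s using Finset.induction_on with
  | empty => simpa using hJ.top_notMem
  | insert a s _ ih =>
    rw [Finset.inf_insert, Finset.forall_mem_insert, ← ih]
    exact ⟨fun h => ⟨fun ha => h (J.lower inf_le_left ha), fun hs => h (J.lower inf_le_right hs)⟩,
      fun h hm => (hJ.mem_or_mem hm).elim h.1 h.2⟩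

variable (J) in
/-- The members of a monotone tuple outside a lower set form a final segment of the indices. -/
theorem exists_rank (f : Tuples n B) :
    ∃ a ≤ n, ∀ i : Set.Icc 1 n, f i ∉ J ↔ n < i.1 + a := by
  classical
  by_cases h : ∃ i, ∃ hi : i ∈ Set.Icc 1 n, f ⟨i, hi⟩ ∉ J
  · obtain ⟨hi, hf⟩ := Nat.find_spec h
    refine ⟨n + 1 - Nat.find h, by have := hi.1; omega, fun j => ⟨fun hj => ?_, fun hj hm => ?_⟩⟩
    · have := Nat.find_min' h ⟨j.2, hj⟩
      have := hi.2
      omega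
    · refine hf (J.lower (f.monotone ?_) hm)
      change Nat.find h ≤ j.1
      have := hi.2
      omega
  · refine ⟨0, Nat.zero_le n, fun j => ⟨fun hj => (h ⟨j.1, j.2, hj⟩).elim, fun hj => ?_⟩⟩
    have := j.2.2
    omega

variable (J) in
/-- The rank of a tuple `f` at `J`: the number of indices `i` with `f i ∉ J`. It is encoded by the
property that these are the last indices, see `notMem_iff_lt_add_rank`. -/
noncomputable def rank (f : Tuples n B) : ℕ := (exists_rank J f).choose

theorem rank_le (f : Tuples n B) : rank J f ≤ n := (exists_rank J f).choose_spec.1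

theorem notMem_iff_lt_add_rank (f : Tuples n B) (i : Set.Icc 1 n) :
    f i ∉ J ↔ n < i.1 + rank J f :=
  (exists_rank J f).choose_spec.2 i

theorem rank_eq {f : Tuples n B} {a : ℕ} (ha : a ≤ n)
    (h : ∀ i : Set.Icc 1 n, f i ∉ J ↔ n < i.1 + a) : rank J f = a := by
  have hr := rank_le (J := J) f
  have key : ∀ i, 1 ≤ i → i ≤ n → (n < i + rank J f ↔ n < i + a) := fun i h1 h2 =>
    (notMem_iff_lt_add_rank f (pt i h1 h2)).symm.trans (h _)
  rcases lt_trichotomy (rank J f) a with hlt | heq | hgt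
  · have := key (n + 1 - a) (by omega) (by omega); omega
  · exact heq
  · have := key (n + 1 - rank J f) (by omega) (by omega); omega

theorem rank_imp (hJ : J.IsPrime) (f g : Tuples n B) :
    rank J (f ⟿ g) = min n (n - rank J f + rank J g) := by
  have hf := rank_le (J := J) f
  have hg := rank_le (J := J) g
  refine rank_eq (min_le_left _ _) fun k => ?_
  have hk := k.2
  have hk1 := hk.1
  have hk2 := hk.2
  rw [imp_apply, finset_inf_notMem_iff hJ]
  simp only [himp_notMem_iff hJ, notMem_iff_lt_add_rank, Finset.mem_univ, true_imp_iff]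
  constructor
  · intro h
    by_contra hcon
    have := h (pt (n + 1 - rank J f) (by omega) (by omega)) (by simp only; omega)
    simp only at this
    omega
  · intro h i hi
    have := i.2.1
    omega

theorem rank_neg (hJ : J.IsPrime) (f : Tuples n B) : rank J ∼f = n - rank J f := by
  have hf := rank_le (J := J) f
  refine rank_eq (Nat.sub_le _ _) fun k => ?_
  have hk1 := k.2.1
  have hk2 := k.2.2
  change (f _)ᶜ ∉ J ↔ _
  rw [compl_notMem_iff hJ, ← not_iff_not, notMem_iff_lt_add_rank]
  simp only
  omega

theorem rank_one (hJ : J.IsPrime) : rank J (WSig.one : Tuples n B) = n :=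
  rank_eq le_rfl fun i => iff_of_true hJ.top_notMem (by have := i.2.1; omega)

theorem rank_eq_iff_notMem (hn : 0 < n) (f : Tuples n B) :
    rank J f = n ↔ f (pt 1 le_rfl hn) ∉ J := by
  rw [notMem_iff_lt_add_rank]
  have hf := rank_le (J := J) f
  simp only
  omega

variable (J) in
/-- The value `rank J f / n` in `[0,1]` of a tuple at a prime ideal. -/
noncomputable def value (f : Tuples n B) : unitInterval :=
  ⟨rank J f / n, by positivity, div_le_one_of_le₀ (by exact_mod_cast rank_le f) n.cast_nonneg⟩

theorem coe_value (f : Tuples n B) : (value J f : ℝ) = rank J f / n := rfl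

theorem isWHom_value (hJ : J.IsPrime) (hn : 0 < n) :
    IsWHom (value J : Tuples n B → unitInterval) where
  map_imp f g := by
    apply Subtype.ext
    rw [coe_imp_of_eq hn (rank_le f) (coe_value f) (coe_value g), coe_value, rank_imp hJ]
  map_neg f := by
    apply Subtype.ext
    have : (n : ℝ) ≠ 0 := by exact_mod_cast hn.ne'
    rw [coe_neg, coe_value, coe_value, rank_neg hJ, Nat.cast_sub (rank_le f)]
    field_simp
  map_one := by
    apply Subtype.ext
    have : (n : ℝ) ≠ 0 := by exact_mod_cast hn.ne'
    rw [coe_value, rank_one hJ, coe_one, div_self this]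

end Rank

/-! ### Homomorphisms into `[0,1]` and their kernels -/

section Kernel

variable {A : Type u} [WajsbergAlgebra A] {f : A → unitInterval}

/-- The kernel of a homomorphism into the chain `[0,1]` is a prime implicative filter. -/
theorem IsWHom.isPrimeImpFilter_kernel (hf : IsWHom f) :
    IsPrimeImpFilter {x | f x = WSig.one} where
  one_mem := hf.map_one
  mp {a b} ha hab := by
    have hab' : f (a ⟿ b) = WSig.one := hab
    rwa [hf.map_imp, show f a = _ from ha, one_imp] at hab'
  ne_univ h := by
    have h0 : f ∼WSig.one = WSig.one := h.symm.subset (Set.mem_univ _)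
    rw [hf.map_neg, hf.map_one, Subtype.ext_iff, coe_neg, coe_one] at h0
    norm_num at h0
  mem_or_mem {a b} h := by
    have h' : f (join a b) = WSig.one := h
    rw [hf.map_join, Subtype.ext_iff, coe_join, coe_one] at h'
    rcases max_choice (f a : ℝ) (f b) with e | e <;> rw [e] at h'
    · exact Or.inl (Subtype.ext h')
    · exact Or.inr (Subtype.ext h')

/-- The quotient by the kernel of a homomorphism `f` into `[0,1]` embeds into every subalgebra that
contains the range of `f`. -/
theorem IsWHom.exists_quot_embedding (hf : IsWHom f) (S : WSubalgebra unitInterval)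
    (hS : ∀ x, f x ∈ S.carrier) :
    ∃ g : hf.isPrimeImpFilter_kernel.toIsImpFilter.Quot → S, IsWHom g ∧ Function.Injective g := by
  have key : ∀ x y : A, (x ⟿ y ∈ {x | f x = WSig.one} ∧ y ⟿ x ∈ {x | f x = WSig.one}) ↔
      f x = f y := by
    intro x y
    change f (x ⟿ y) = WSig.one ∧ f (y ⟿ x) = WSig.one ↔ _
    rw [hf.map_imp, hf.map_imp]
    exact ⟨fun h => Le.antisymm h.1 h.2, fun h => by rw [h]; exact ⟨Le.refl _, Le.refl _⟩⟩
  refine ⟨Quotient.lift (fun x => ⟨f x, hS x⟩) fun x y h => Subtype.ext ((key x y).1 h),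
    ⟨?_, ?_, ?_⟩, ?_⟩
  · intro x y
    induction x, y using Quotient.inductionOn₂ with
    | h x y => exact Subtype.ext (hf.map_imp x y)
  · intro x
    induction x using Quotient.inductionOn with
    | h x => exact Subtype.ext (hf.map_neg x)
  · exact Subtype.ext hf.map_one
  · intro x y h
    induction x, y using Quotient.inductionOn₂ with
    | h x y => exact Quotient.sound ((key x y).2 (congrArg Subtype.val h))

end Kernel

/-! ### Subalgebras of the finite chains -/

/-- A set of numerators `k ≤ n` that is closed under the operations of `L n` consists of the
multiples of a divisor `m` of `n`; so the subalgebras of `L n` are the `L d` with `d ∣ n`. -/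
theorem exists_dvd_of_closed {n : ℕ} (hn : 0 < n) {S : Set ℕ} (hle : ∀ k ∈ S, k ≤ n)
    (hone : n ∈ S) (hneg : ∀ k ∈ S, n - k ∈ S)
    (himp : ∀ k ∈ S, ∀ l ∈ S, min n (n - k + l) ∈ S) :
    ∃ m, 0 < m ∧ m ∣ n ∧ ∀ k ≤ n, k ∈ S ↔ m ∣ k := by
  classical
  have hsub : ∀ k ∈ S, ∀ l ∈ S, k - l ∈ S := by
    intro k hk l hl
    have := hneg _ (himp k hk l hl)
    have e : n - min n (n - k + l) = k - l := by have := hle k hk; omega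
    rwa [e] at this
  have hex : ∃ k, 0 < k ∧ k ∈ S := ⟨n, hn, hone⟩
  obtain ⟨hm, hmS⟩ := Nat.find_spec hex
  have hmin : ∀ k ∈ S, k < Nat.find hex → k = 0 := by
    intro k hk hlt
    by_contra h0
    exact Nat.find_min hex hlt ⟨Nat.pos_of_ne_zero h0, hk⟩
  generalize Nat.find hex = m at hm hmS hmin
  have hmul : ∀ k ∈ S, ∀ j, k - m * j ∈ S := by
    intro k hk j
    induction j with
    | zero => exact hk
    | succ j ih =>
      have := hsub _ ih _ hmS
      rwa [Nat.sub_sub, ← Nat.mul_succ] at this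
  have hdvd : ∀ k ∈ S, m ∣ k := by
    intro k hk
    have h := hmul k hk (k / m)
    have e : k - m * (k / m) = k % m := by have := Nat.div_add_mod k m; omega
    rw [e] at h
    -- `k % m` is in `S` and below the least positive member `m`
    exact Nat.dvd_of_mod_eq_zero (hmin _ h (Nat.mod_lt _ hm))
  refine ⟨m, hm, hdvd n hone, fun k hk => ⟨hdvd k, fun hkm => ?_⟩⟩
  -- `n - k` is a multiple of `m`, and `k = n - (n - k)`
  obtain ⟨j, hj⟩ := Nat.dvd_sub (hdvd n hone) hkm
  have := hmul n hone j
  rwa [← hj, Nat.sub_sub_self hk] at this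

/-! ### The image of the embedding -/

section Image

variable {A : Type u} [WajsbergAlgebra A] {n : ℕ}

/-- Modulo a prime filter `P` with `A/P ⊆ L d`, every `x` takes a value `k/d`, at which `σ_i` is
constant for `i` in a block of length `n/d`; hence the conditions `ξ_{d,q}` hold in `P`. -/
theorem modal_mem_M (hA : IsValued n A) (hn : 0 < n) (x : A) :
    modal hA hn x ∈ (M (skelFilter A n)).carrier := by
  intro d q
  refine (mem_skelFilter A).2 ?_
  rintro P hP ⟨g, hg, hinj⟩
  have hd := Nat.dvd_of_mem_divisors d.2
  have hd0 := Nat.pos_of_dvd_of_pos hd hn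
  have hdm : d.1 * (n / d.1) = n := Nat.mul_div_cancel' hd
  obtain ⟨p, hp⟩ : ∃ p, q.1 = p + 1 := ⟨q.1 - 1, by have := q.2.1; omega⟩
  have hend := (block_end_mem d q).2
  have hstart := (block_start_le d q).trans hend
  -- the quotient map followed by the inclusions of `A/P` into `L d` and of `L d` into `[0,1]`
  let π : A → unitInterval := fun a => (g (Quotient.mk hP.toIsImpFilter.con a)).1
  have hπ : IsWHom π :=
    ⟨fun a b => congrArg Subtype.val (hg.map_imp (Quotient.mk _ a) (Quotient.mk _ b)),
      fun a => congrArg Subtype.val (hg.map_neg (Quotient.mk _ a)),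
      congrArg Subtype.val hg.map_one⟩
  have hmem : ∀ a, π a = WSig.one → a ∈ P := by
    intro a ha
    have h1 : g (Quotient.mk hP.toIsImpFilter.con a) =
        g (Quotient.mk hP.toIsImpFilter.con WSig.one) :=
      Subtype.ext (ha.trans (congrArg Subtype.val hg.map_one).symm)
    have h2 := (Quotient.exact (hinj h1)).2
    rwa [one_imp] at h2
  refine hmem _ ?_
  unfold xi
  rw [Skel.coe_himp, hπ.map_imp]
  change π (sigma n (q.1 * (n / d.1)) x) ⟿ π (sigma n ((q.1 - 1) * (n / d.1) + 1) x) = _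
  rw [hπ.map_sigma, hπ.map_sigma]
  obtain ⟨k, -, hk⟩ := (mem_L_iff hd0 _).1 (g (Quotient.mk hP.toIsImpFilter.con x)).2
  refine le_iff_coe.2 ?_
  rw [coe_sigma hn hdm hend hk, coe_sigma hn hdm hstart hk]
  -- with `m = n / d`: since `d m = n`, `n < q m + k m` forces `n ≤ (q - 1) m + k m`
  have key : n < q.1 * (n / d.1) + n / d.1 * k → n < (q.1 - 1) * (n / d.1) + 1 + n / d.1 * k := by
    rw [hp, Nat.add_sub_cancel, Nat.mul_comm (n / d.1) k, ← Nat.add_mul]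
    intro h
    have h1 : d.1 < p + 1 + k := by
      refine lt_of_mul_lt_mul_right (a := n / d.1) ?_ (Nat.zero_le _)
      rwa [hdm]
    have h2 : d.1 * (n / d.1) ≤ (p + k) * (n / d.1) := Nat.mul_le_mul_right _ (by omega)
    rw [hdm, Nat.add_mul] at h2
    omega
  by_cases h : n < q.1 * (n / d.1) + n / d.1 * k
  · rw [if_pos h, if_pos (key h)]
  · rw [if_neg h]
    split_ifs <;> norm_num

/-- Surjectivity at a prime ideal `J` of `B(A)`: the values of `A` at `J` are the multiples of some
`1/d` with `d ∣ n`, and so is the value of a tuple in `M(B(A), h_A)`. -/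
theorem exists_rank_modal_eq (hA : IsValued n A) (hn : 0 < n) {J : Order.Ideal (Skel A)}
    (hJ : J.IsPrime) {f : Tuples n (Skel A)} (hf : f ∈ (M (skelFilter A n)).carrier) :
    ∃ x, rank J (modal hA hn x) = rank J f := by
  have hφ := isWHom_modal hA hn
  obtain ⟨m, hm, hmn, hS⟩ := exists_dvd_of_closed hn
    (S := Set.range fun x => rank J (modal hA hn x))
    (by rintro _ ⟨x, rfl⟩; exact rank_le _)
    ⟨WSig.one, by simp only [hφ.map_one, rank_one hJ]⟩
    (by rintro _ ⟨x, rfl⟩; exact ⟨∼x, by simp only [hφ.map_neg, rank_neg hJ]⟩)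
    (by
      rintro _ ⟨x, rfl⟩ _ ⟨y, rfl⟩
      exact ⟨x ⟿ y, by simp only [hφ.map_imp, rank_imp hJ]⟩)
  refine (hS _ (rank_le f)).2 ?_
  obtain ⟨d, hd⟩ := hmn
  have hd0 : 0 < d := Nat.pos_of_ne_zero (by rintro rfl; omega)
  have hdn : n / d = m := Nat.div_eq_of_eq_mul_left hd0 hd
  let π : A → unitInterval := fun x => value J (modal hA hn x)
  have hπ : IsWHom π :=
    ⟨fun x y => by simp only [π, hφ.map_imp, (isWHom_value hJ hn).map_imp],
      fun x => by simp only [π, hφ.map_neg, (isWHom_value hJ hn).map_neg],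
      by simp only [π, hφ.map_one, (isWHom_value hJ hn).map_one]⟩
  have hrange : ∀ x, π x ∈ (L d).carrier := by
    intro x
    obtain ⟨k, hk⟩ := (hS _ (rank_le _)).1 ⟨x, rfl⟩
    refine ⟨k, ?_⟩
    simp only [π, coe_value]
    rw [hk, hd]
    have : (m : ℝ) ≠ 0 := by exact_mod_cast hm.ne'
    have : (d : ℝ) ≠ 0 := by exact_mod_cast hd0.ne'
    push_cast
    field_simp
  -- the Boolean elements of `P_d` are outside `J`
  have hout : ∀ b ∈ skelFilter A n ⟨d, Nat.mem_divisors.2 ⟨⟨m, by rw [hd, mul_comm]⟩, hn.ne'⟩⟩,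
      b ∉ J := by
    intro b hb
    have h : π b.1 = WSig.one :=
      hb _ hπ.isPrimeImpFilter_kernel (hπ.exists_quot_embedding (L d) hrange)
    have h1 : (rank J (modal hA hn b.1) : ℝ) / n = 1 := congrArg Subtype.val h
    rw [div_eq_one_iff_eq (by exact_mod_cast hn.ne'), Nat.cast_inj, rank_eq_iff_notMem hn] at h1
    rwa [show modal hA hn b.1 (pt 1 le_rfl hn) = b from
      Subtype.ext (sigma_of_odot_self b.2 le_rfl hn)] at h1
  by_contra hndvd
  have ha := rank_le (J := J) f
  have ha0 : rank J f ≠ 0 := fun h => hndvd (h ▸ dvd_zero m)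
  have han : rank J f ≠ n := fun h => hndvd (by rw [h]; exact ⟨d, hd⟩)
  -- the last index with `f i ∈ J` and its successor are in the same block of length `m`
  have hblock : (n + 1 - rank J f - 1) / (n / d) = (n - rank J f - 1) / (n / d) := by
    have e : n + 1 - rank J f - 1 = (n - rank J f - 1) + 1 := by omega
    rw [hdn, e, Nat.succ_div, if_neg, add_zero]
    intro h
    have e' : n - rank J f - 1 + 1 = n - rank J f := by omega
    rw [e'] at h
    exact hndvd ((Nat.dvd_sub_iff_right ha ⟨d, hd⟩).1 h)
  have hhimp := hout _ (himp_mem_of_block _ _ f (hf _)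
    (pt (n + 1 - rank J f) (by omega) (by omega)) (pt (n - rank J f) (by omega) (by omega)) hblock)
  rw [himp_notMem_iff hJ, notMem_iff_lt_add_rank, notMem_iff_lt_add_rank] at hhimp
  simp only at hhimp
  omega

/-- The elements `b` of `B(A)` on which `f` agrees with some `φ(x)` form an ideal. -/
def agreement (hA : IsValued n A) (hn : 0 < n) (f : Tuples n (Skel A)) : Order.Ideal (Skel A) where
  carrier := {b | ∃ x, ∀ i, b ⊓ modal hA hn x i = b ⊓ f i}
  lower' := by
    rintro b c hcb ⟨x, hx⟩
    refine ⟨x, fun i => ?_⟩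
    rw [← inf_eq_left.2 hcb, inf_assoc, inf_assoc, hx]
  nonempty' := ⟨⊥, zero, fun i => by rw [bot_inf_eq, bot_inf_eq]⟩
  directed' := by
    rintro b ⟨x, hx⟩ c ⟨y, hy⟩
    -- patch `x` on `b` with `y` on the complement of `b`
    refine ⟨b ⊔ c, ⟨join (meet b.1 x) (meet ∼b.1 y), fun i => ?_⟩, le_sup_left, le_sup_right⟩
    have e : modal hA hn (join (meet b.1 x) (meet ∼b.1 y)) i =
        (b ⊓ modal hA hn x i) ⊔ (bᶜ ⊓ modal hA hn y i) := by
      apply Subtype.ext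
      change sigma n i.1 _ = join (meet b.1 (sigma n i.1 x)) (meet ∼b.1 (sigma n i.1 y))
      rw [sigma_join hA hn i.2.2, sigma_meet hA hn i.2.2, sigma_meet hA hn i.2.2,
        sigma_of_odot_self b.2 i.2.1 i.2.2, sigma_of_odot_self (odot_self_neg b.2) i.2.1 i.2.2]
    have e' : (b ⊔ c) ⊓ (bᶜ ⊓ modal hA hn y i) = (b ⊔ c) ⊓ (bᶜ ⊓ f i) := by
      have h : (b ⊔ c) ⊓ bᶜ = bᶜ ⊓ c := by
        rw [inf_sup_right, inf_compl_eq_bot, bot_sup_eq, inf_comm]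
      rw [← inf_assoc, ← inf_assoc, h, inf_assoc, inf_assoc, hy]
    rw [e, inf_sup_left, e', hx, ← inf_sup_left, ← inf_sup_right, sup_compl_eq_top, top_inf_eq]

/-- The map `φ` is onto: if the ideal `agreement` were proper, it would lie in a prime ideal `J`, and
`exists_rank_modal_eq` yields a member of `agreement` outside `J`. -/
theorem exists_modal_eq (hA : IsValued n A) (hn : 0 < n) {f : Tuples n (Skel A)}
    (hf : f ∈ (M (skelFilter A n)).carrier) : ∃ x, modal hA hn x = f := by
  by_contra hcon
  have htop : ⊤ ∉ agreement hA hn f := by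
    rintro ⟨x, hx⟩
    refine hcon ⟨x, ?_⟩
    ext i
    simpa only [top_inf_eq] using hx i
  obtain ⟨J, hJ, hle, -⟩ := DistribLattice.prime_ideal_of_disjoint_filter_ideal
    (F := Order.PFilter.principal ⊤) (I := agreement hA hn f) (by
      rw [Set.disjoint_left]
      intro b hb hb'
      rw [SetLike.mem_coe, Order.PFilter.mem_principal, top_le_iff] at hb
      exact htop (hb ▸ hb'))
  obtain ⟨x, hx⟩ := exists_rank_modal_eq hA hn hJ hf
  have hxf : ∀ i, modal hA hn x i ∉ J ↔ f i ∉ J := fun i => by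
    rw [notMem_iff_lt_add_rank, notMem_iff_lt_add_rank, hx]
  -- the element on which `φ(x)` and `f` agree lies in the ideal but not in `J`
  have hb : (Finset.univ.inf fun i => (modal hA hn x i ⇨ f i) ⊓ (f i ⇨ modal hA hn x i)) ∉ J := by
    rw [finset_inf_notMem_iff hJ]
    intro i _ h
    rcases hJ.mem_or_mem h with h | h
    · exact (himp_notMem_iff hJ).2 (hxf i).1 h
    · exact (himp_notMem_iff hJ).2 (hxf i).2 h
  refine hb (hle ⟨x, fun i => ?_⟩)
  have hi := Finset.inf_le (f := fun i => (modal hA hn x i ⇨ f i) ⊓ (f i ⇨ modal hA hn x i))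
    (Finset.mem_univ i)
  refine le_antisymm (le_inf inf_le_left ?_) (le_inf inf_le_left ?_)
  · exact le_himp_iff.1 (hi.trans inf_le_left)
  · exact le_himp_iff.1 (hi.trans inf_le_right)

end Image

end Wajsberg

/-- For every `(n+1)`-valued Wajsberg algebra `A`, the map `φ(x)(i) = σ_i(x)`, `1 ≤ i ≤ n`, is a
well-defined `W`-isomorphism from `A` onto `M(B(A), h_A)`. -/
theorem mainTheorem1 {A : Type*} [Wajsberg.WajsbergAlgebra A] (n : ℕ) (hn : 1 ≤ n)
    (hA : Wajsberg.IsValued n A) :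
    ∃ φ : A → Wajsberg.M (Wajsberg.skelFilter A n),
      (∀ (x : A) (i : Set.Icc 1 n), ((φ x).1 i).1 = Wajsberg.sigma n i.1 x) ∧
        Wajsberg.IsWIso φ := by
  have hφ := Wajsberg.isWHom_modal hA hn
  refine ⟨fun x => ⟨Wajsberg.modal hA hn x, Wajsberg.modal_mem_M hA hn x⟩, fun _ _ => rfl,
    ⟨fun x y => Subtype.ext (hφ.map_imp x y), fun x => Subtype.ext (hφ.map_neg x),
      Subtype.ext hφ.map_one⟩,
    fun x y h => Wajsberg.modal_injective hA hn (congrArg Subtype.val h), fun f => ?_⟩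
  obtain ⟨x, hx⟩ := Wajsberg.exists_modal_eq hA hn f.2
  exact ⟨x, Subtype.ext hx⟩
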